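/- **Setting.** $W$ takes values in a finite set (also written $W$), $T\in\{0,1\}$, $Y\in\mathbb R$. $Q$ (uncontaminated source) and $P$ (target) are probability distributions of $(W,T,Y)$ with $P(T=t)>0$ for both $t$, $P(Y\mid T,W)=Q(Y\mid T,W)$ on every cell $(w,t)$ charged by $P$, and overlap $Q(W=w,T=t)\ge\rho>0$ for all $w,t$. The conditional law $Q(Y\mid t,w)$ has mean $\mu_{w,t}$, a finite fourth moment, standard deviation at most $\sigma_{w,t}\ge 0$, and $E_Q[(Y-\mu_{w,t})^4\mid t,w]\le C\sigma_{w,t}^4$ with $C\ge 0$. An unobserved variable $U$ contaminates an $\eta$-fraction of outcomes (Huber model): the observed law has the same distribution of $(W,T)$, and given $W=w,T=t$ one observes $$Y\sim(1-\eta)\,Q(Y\mid t,w)+\eta\, N_{w,t},\qquad N_{w,t}=\int Q(Y\mid t,w,u)\,Q(du\mid t,w),$$ where the law of $U$ given $(t,w)$ and the law of $Y$ given $(t,w,u)$ for the affected units are arbitrary. We observe $n$ i.i.d. records $(W_i,T_i,Y_i)$ of the observed law. **Robust estimator.** For each cell $(w,t)$ let $\hat Y(w,t)$ be the one-dimensional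 agnostic mean (Lai–Rao–Vempala) of the $Y_i$ with $W_i=w,T_i=t$: the average of those lying in a shortest closed interval that contains at least a fraction $(1-\eta)(1-\eta-\varepsilon)$ of them (ties broken arbitrarily). A robust version of a distribution of $(W,T,Y)$ is a probability distribution with the same $(W,T)$-marginal whose conditional mean of $Y$ given $(t,w)$ is $\hat Y(w,t)$ on every cell of positive mass. $Q_B$ and $\hat Q_B$ denote robust versions of $Q$ and of the empirical distribution of the sample. A valid weighted representation is a probability distribution $R$ with $R(T=t)>0$ for both $t$ and $R(w\mid t)=\beta_B(w,t)Q_B(w\mid t)$ for a weight $\beta_B\ge0$; $\hat\beta_B$ is any real-valued (possibly data-dependent) function of $(w,t)$. Put $$h(x_R)=\hat E_R[Y\mid T=1]-\hat E_R[Y\mid T=0],\quad \hat E_R[Y\mid T=t]=\frac1{|\{i:T_i=t\}|}\sum_{i:T_i=t}\hat\beta_B(W_i,t)\hat Y(W_i,t),$$ $$h^\infty(x_P)=E_P[Y\mid T=1]-E_P[Y\mid T=0],\qquad L(a,b)=|a-b|,$$ $$\alpha_{T=t}(M,\beta)=\sum_w\beta(w,t)M(w\mid t)E_M[Y\mid t,w],\qquad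 WLD_{T=t}(\beta_BQ_B,P)=\sum_w\big(R(w\mid t)-P(w\mid t)\big)E_Q[Y\mid t,w].$$ **Theorem 5.2.** Let $\eta_0<1$ with $\eta_0<(1-\eta_0)^2$. There is a constant $K>0$ depending only on $\eta_0$ such that for all $W$, $\varepsilon>0$, $\rho>0$ and $k\in\mathbb N$ there is $n_0$ (depending only on $\eta_0,W,\varepsilon,\rho,k$) such that for all $n\ge n_0$, all $\eta\ge0$ with $\eta+\varepsilon\le\eta_0$, all $C$ and $\sigma$, and all distributions as above, with probability at least $(1-n^{-k})^{2|W|}$ the following holds. There are reals $\delta_{w,t}$ with $|\delta_{w,t}|\le K\,C^{1/4}(\eta+\varepsilon)^{3/4}\sigma_{w,t}$ such that for all $Q_B,\hat Q_B,\hat\beta_B$ and every valid weighted representation $R$ (with weight $\beta_B$), $$L(h(x_R),h^\infty(x_P))\le\sum_{t\in\{0,1\}}\Big(\big|WLD_{T=t}(\beta_BQ_B,P)\big|+\big|\alpha_{T=t}(\hat Q_B,\hat\beta_B)-\alpha_{T=t}(Q_B,\beta_B)-\gamma_t\big|\Big),\qquad \gamma_t=\sum_w R(w\mid t)\,\delta_{w,t}.$$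 If moreover $R(w\mid t)=Q(w)$ for all $w,t$ (inverse propensity weighting), or if $\sigma_{w,t}=\sigma$ does not depend on $(w,t)$, then the same inequality holds with $\gamma_t=\sum_w Q(w)\,\delta'_{w,t}$ for suitable reals $\delta'_{w,t}$ with $|\delta'_{w,t}|\le K\,C^{1/4}(\eta+\varepsilon)^{3/4}\sigma_{w,t}$, that is, $\gamma_t=\sum_W Q(W)\cdot O(C^{1/4}(\eta+\varepsilon)^{3/4}\sigma)$. -/

import Mathlib

open MeasureTheory ProbabilityTheory

noncomputable section

namespace CausalBound

/-- One record `(W, T, Y)`: covariate, binary treatment (`true` is `T = 1`), real outcome. -/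
abbrev Obs (W : Type*) : Type _ := W × Bool × ℝ

/-- The event `T = t`. -/
def evT {W : Type*} (t : Bool) : Set (Obs W) := {x | x.2.1 = t}

/-- The event `W = w, T = t`. -/
def evWT {W : Type*} (w : W) (t : Bool) : Set (Obs W) := {x | x.1 = w ∧ x.2.1 = t}

section Laws

variable {W : Type*} [MeasurableSpace W]

/-- `μ(W = w)`. -/
def margW (μ : Measure (Obs W)) (w : W) : ℝ := μ.real {x | x.1 = w}

/-- `μ(W = w | T = t)`. -/
def condW (μ : Measure (Obs W)) (t : Bool) (w : W) : ℝ :=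
  (ProbabilityTheory.cond μ (evT t)).real {x | x.1 = w}

/-- The conditional law `μ(Y | W = w, T = t)`. -/
def condY (μ : Measure (Obs W)) (w : W) (t : Bool) : Measure ℝ :=
  (ProbabilityTheory.cond μ (evWT w t)).map (fun x => x.2.2)

/-- `E_μ[Y | W = w, T = t]`. -/
def condMean (μ : Measure (Obs W)) (w : W) (t : Bool) : ℝ := ∫ y, y ∂(condY μ w t)

/-- `E_μ[Y | T = t]`. -/
def meanGivenT (μ : Measure (Obs W)) (t : Bool) : ℝ :=
  ∫ x, x.2.2 ∂(ProbabilityTheory.cond μ (evT t))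

/-- The average predictive effect `E_μ[Y | T = 1] - E_μ[Y | T = 0]`; for the target
distribution this is the average causal effect. -/
def ape (μ : Measure (Obs W)) : ℝ := meanGivenT μ true - meanGivenT μ false

/-- Weighted L1 distance: `∑_w (R(w | t) - P(w | t)) E_Q[Y | t, w]`. -/
def wld [Fintype W] (Q R P : Measure (Obs W)) (t : Bool) : ℝ :=
  ∑ w, (condW R t w - condW P t w) * condMean Q w t

/-- `α_t(μ, β) = ∑_w β(w, t) μ(w | t) E_μ[Y | t, w]`. -/
def alpha [Fintype W] (μ : Measure (Obs W)) (β : W → Bool → ℝ) (t : Bool) : ℝ :=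
  ∑ w, β w t * condW μ t w * condMean μ w t

/-- `R` is a valid weighted representation of `μ` with weights `β`: a probability distribution
with `R(W | T) = β(W, T) μ(W | T)`. Only the `(W, T)`-part of `R` matters below, so its
conditional law of `Y` is left free. -/
structure IsWeightedRep (μ : Measure (Obs W)) (β : W → Bool → ℝ) (R : Measure (Obs W)) :
    Prop where
  prob : IsProbabilityMeasure R
  nonneg : ∀ w t, 0 ≤ β w t
  pos : ∀ t, R (evT t) ≠ 0
  weight : ∀ w t, condW R t w = β w t * condW μ t w

/-- Causal invariance: `P(Y | T, W) = Q(Y | T, W)` wherever `P` charges the cell. -/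
def CausalInvariant (Q P : Measure (Obs W)) : Prop :=
  ∀ w t, P (evWT w t) ≠ 0 → condY P w t = condY Q w t

/-- `Qobs` is the observed law when an unobserved `U` contaminates an `η`-fraction of the outcomes
of `Q`: `(W, T)` has the same law, and given `W = w, T = t`
`Y ∼ (1 - η) Q(Y | t, w) + η ∫ QYU(Y | t, w, u) QU(du | t, w)`.
No moment or other condition is put on `QU` and `QYU` (an arbitrary adversary who sees `w, t`). -/
structure IsHuberContamination {U : Type*} [MeasurableSpace U] (η : ℝ)
    (Q Qobs : Measure (Obs W)) (QU : W → Bool → Measure U) (QYU : W → Bool → Kernel U ℝ) :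
    Prop where
  marginal : ∀ w t, Qobs (evWT w t) = Q (evWT w t)
  mixture : ∀ w t, condY Qobs w t
    = ENNReal.ofReal (1 - η) • condY Q w t + ENNReal.ofReal η • (QU w t).bind (QYU w t)

/-- `ν` is a robust version of `μ` for the robust conditional means `m`: it has the
`(W, T)`-marginal of `μ`, and `E_ν[Y | W = w, T = t] = m(w, t)` on every cell of positive mass. -/
structure IsRobustVersion (μ : Measure (Obs W)) (m : W → Bool → ℝ) (ν : Measure (Obs W)) :
    Prop where
  prob : IsProbabilityMeasure ν
  marginal : ∀ w t, ν (evWT w t) = μ (evWT w t)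
  integrable : ∀ w t, μ (evWT w t) ≠ 0 → Integrable (fun y : ℝ => y) (condY ν w t)
  mean : ∀ w t, μ (evWT w t) ≠ 0 → condMean ν w t = m w t

/-- Empirical distribution of a sample. -/
def empirical {n : ℕ} (x : Fin n → Obs W) : Measure (Obs W) :=
  (n : ENNReal)⁻¹ • ∑ i, Measure.dirac (x i)

/-- `|wld₁| + |wld₀| + |α₁(Q̂_B, β̂) - α₁(Q_B, β) - γ₁| + |α₀(Q̂_B, β̂) - α₀(Q_B, β) - γ₀|`. -/
def lossBound [Fintype W] (Q P R QB QBhat : Measure (Obs W)) (β βhat : W → Bool → ℝ)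
    (γ : Bool → ℝ) : ℝ :=
  |wld Q R P true| + |wld Q R P false|
    + |alpha QBhat βhat true - alpha QB β true - γ true|
    + |alpha QBhat βhat false - alpha QB β false - γ false|

end Laws

/-- The L1 loss. -/
def l1Loss (a b : ℝ) : ℝ := |a - b|

/-- `[a, b]` is a shortest closed interval containing at least a fraction `q` of the numbers
`y i`, `i ∈ s`. -/
def IsShortestInterval {ι : Type*} (y : ι → ℝ) (s : Finset ι) (q a b : ℝ) : Prop :=
  a ≤ b ∧ q * (s.card : ℝ) ≤ ((s.filter fun i => a ≤ y i ∧ y i ≤ b).card : ℝ) ∧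
    ∀ a' b' : ℝ, a' ≤ b' →
      q * (s.card : ℝ) ≤ ((s.filter fun i => a' ≤ y i ∧ y i ≤ b').card : ℝ) → b - a ≤ b' - a'

/-- `m` is an output of the one-dimensional agnostic mean estimator of Lai, Rao and Vempala (with
outlier truncation) on the points `y i`, `i ∈ s`: the average of the points in a shortest interval
containing a fraction `(1 - η)(1 - η - ε)` of them. Ties may be broken in any way. -/
def IsAgnosticMean {ι : Type*} (η ε : ℝ) (y : ι → ℝ) (s : Finset ι) (m : ℝ) : Prop :=
  ∃ a b : ℝ, IsShortestInterval y s ((1 - η) * (1 - η - ε)) a b ∧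
    m = (∑ i ∈ s.filter (fun i => a ≤ y i ∧ y i ≤ b), y i) /
      ((s.filter fun i => a ≤ y i ∧ y i ≤ b).card : ℝ)

/-- The sample indices with `W = w, T = t`. -/
def cell {W : Type*} [DecidableEq W] {n : ℕ} (x : Fin n → Obs W) (w : W) (t : Bool) :
    Finset (Fin n) :=
  Finset.univ.filter fun i => (x i).1 = w ∧ (x i).2.1 = t

/-- The weighted sample estimate of `E_R[Y | T = t]`, with outcomes replaced by the robust
conditional means `m`: the average of `β̂(W_i, T_i) m(W_i, T_i)` over the units with `T_i = t`. -/
def weightedMean {W : Type*} {n : ℕ} (x : Fin n → Obs W) (βhat m : W → Bool → ℝ) (t : Bool) : ℝ :=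
  (∑ i ∈ Finset.univ.filter (fun i => (x i).2.1 = t), βhat (x i).1 t * m (x i).1 t) /
    ((Finset.univ.filter fun i => (x i).2.1 = t).card : ℝ)

/-- The weighted estimator `h(x_R)` of the average causal effect. -/
def hEst {W : Type*} {n : ℕ} (x : Fin n → Obs W) (βhat m : W → Bool → ℝ) : ℝ :=
  weightedMean x βhat m true - weightedMean x βhat m false

end CausalBound

end

noncomputable section

namespace CausalBound

/-! ### Integrals over an interval and the masses of its subintervals -/

/-! The loss bound rests on an exact identity. By causal invariance `E_P[Y | T = t] = ∑_w P(w | t)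
E_Q[Y | t, w]`, and the sample estimate is `α_t(Q̂_B, β̂)` because empty cells carry no weight.
Since `α_t(Q_B, β) = ∑_w R(w | t) Ŷ(w, t)`, the error in arm `t` equals the WLD term plus the
difference of the two `α_t` minus `γ_t`, with `δ = E_Q[Y | t, w] - Ŷ(w, t)` (`l1Loss_le_lossBound`).
It remains to bound `δ`, uniformly over all laws.

For one cell put `τ = η + ε`, `B = C^{1/4} σ`, `L = B τ^{-1/4}`, so the fourth moment is at most `L⁴
τ`. By Markov, the interval of radius `2L` around the mean `c` has enough mass, so the shortest
interval `J` has length at most `4L`. The breakdown condition `η₀ < (1 - η₀)²` leaves clean mass in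
`J`, which keeps `J` within `O(L)` of `c`. Hence sampling error and contamination, each of mass at
most `τ`, shift the integral of `y - c` over `J` by `O(Lτ)`. The clean part does the same: its mean
is `c`, so only the discarded tail counts. The error is `O(Lτ) = O(B τ^{3/4})`
(`abs_setIntegral_Icc_sub_le_of_huber`).

The sampling error on intervals is reduced to finitely many events by a grid of quantiles
(`exists_grid`). The number of events does not depend on the law, so Hoeffding and a union bound
give a uniform `n₀`. -/

lemma integrableOn_Icc_sub (ν : Measure ℝ) [IsFiniteMeasure ν] (a b c : ℝ) :
    IntegrableOn (fun y => y - c) (Set.Icc a b) ν :=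
  (continuous_id.sub continuous_const).continuousOn.integrableOn_compact isCompact_Icc

/-- Layer-cake formula: on `[a, b]` the function `y - a` is nonnegative, and its superlevel sets are
again closed intervals. -/
lemma setIntegral_Icc_sub_left (ν : Measure ℝ) [IsFiniteMeasure ν] (a b : ℝ) :
    ∫ y in Set.Icc a b, (y - a) ∂ν = ∫ t in Set.Ioc 0 (b - a), ν.real (Set.Icc (a + t) b) := by
  rw [Integrable.integral_eq_integral_Ioc_meas_le (M := b - a) (integrableOn_Icc_sub ν a b a)]
  · refine setIntegral_congr_fun measurableSet_Ioc fun t ht => ?_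
    have hm : MeasurableSet {y : ℝ | t ≤ y - a} :=
      measurableSet_le measurable_const (measurable_id.sub_const a)
    simp only [measureReal_restrict_apply hm]
    congr 1
    ext y
    simp only [Set.mem_inter_iff, Set.mem_ofPred_eq, Set.mem_Icc]
    have := ht.1
    constructor
    · rintro ⟨h1, h2, h3⟩
      exact ⟨by linarith, h3⟩
    · rintro ⟨h1, h2⟩
      exact ⟨by linarith, by linarith, h2⟩
  · filter_upwards [ae_restrict_mem measurableSet_Icc] with y hy
    simpa using hy.1
  · filter_upwards [ae_restrict_mem measurableSet_Icc] with y hy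
    linarith [hy.2]

lemma integrableOn_measureReal_Icc (ν : Measure ℝ) [IsFiniteMeasure ν] (a b c : ℝ) :
    IntegrableOn (fun t => ν.real (Set.Icc (a + t) b)) (Set.Ioc 0 c) := by
  have h : Antitone fun t => ν.real (Set.Icc (a + t) b) := fun s t hst =>
    measureReal_mono (Set.Icc_subset_Icc_left (by linarith))
  exact (h.antitoneOn (Set.Icc 0 c)).integrableOn_isCompact isCompact_Icc |>.mono_set
    Set.Ioc_subset_Icc_self

/-- If two finite measures agree up to `e` on closed intervals, then so do the integrals of
`y - c` over `[a, b]`, up to `e` times the variation of `(y - c) 1_[a,b]`. -/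
lemma abs_setIntegral_Icc_sub_le {ν₁ ν₂ : Measure ℝ} [IsFiniteMeasure ν₁] [IsFiniteMeasure ν₂]
    {e : ℝ} (h : ∀ c d, |ν₁.real (Set.Icc c d) - ν₂.real (Set.Icc c d)| ≤ e)
    {a b : ℝ} (hab : a ≤ b) (c : ℝ) :
    |∫ y in Set.Icc a b, (y - c) ∂ν₁ - ∫ y in Set.Icc a b, (y - c) ∂ν₂|
      ≤ e * (b - a + |a - c|) := by
  -- Layer cake needs the base point `a`; the remaining constant `a - c` multiplies the mass of `[a,
  -- b]`. The two terms produce the errors `e (b - a)` and `e |a - c|`.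
  have key : ∀ ν : Measure ℝ, IsFiniteMeasure ν → ∫ y in Set.Icc a b, (y - c) ∂ν
      = (∫ t in Set.Ioc 0 (b - a), ν.real (Set.Icc (a + t) b))
        + (a - c) * ν.real (Set.Icc a b) := by
    intro ν _
    rw [← setIntegral_Icc_sub_left]
    rw [show (fun y : ℝ => y - c) = fun y => (y - a) + (a - c) from funext fun y => by ring]
    rw [integral_add (integrableOn_Icc_sub ν a b a) (integrable_const _)]
    simp [mul_comm]
  rw [key ν₁ inferInstance, key ν₂ inferInstance]
  have h1 : |∫ t in Set.Ioc 0 (b - a), (ν₁.real (Set.Icc (a + t) b) - ν₂.real (Set.Icc (a + t) b))|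
      ≤ e * (b - a) := by
    have := norm_setIntegral_le_of_norm_le_const (μ := volume) (s := Set.Ioc 0 (b - a)) (C := e)
      (f := fun t => ν₁.real (Set.Icc (a + t) b) - ν₂.real (Set.Icc (a + t) b))
      (by simp) (fun t _ => h _ _)
    simpa [hab] using this
  rw [integral_sub (integrableOn_measureReal_Icc ν₁ a b _)
    (integrableOn_measureReal_Icc ν₂ a b _)] at h1
  have h2 : |(a - c) * ν₁.real (Set.Icc a b) - (a - c) * ν₂.real (Set.Icc a b)|
      ≤ e * |a - c| := by
    rw [← mul_sub, abs_mul, mul_comm]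
    exact mul_le_mul_of_nonneg_right (h a b) (abs_nonneg _)
  calc _ = |((∫ t in Set.Ioc 0 (b - a), ν₁.real (Set.Icc (a + t) b))
            - ∫ t in Set.Ioc 0 (b - a), ν₂.real (Set.Icc (a + t) b))
          + ((a - c) * ν₁.real (Set.Icc a b) - (a - c) * ν₂.real (Set.Icc a b))| := by
        congr 1; ring
    _ ≤ e * (b - a) + e * |a - c| := (abs_add_le _ _).trans (add_le_add h1 h2)
    _ = _ := by ring

/-! ### Tails under a fourth moment bound -/

/-- A fourth moment bound `E (y - c)⁴ ≤ L⁴ τ` controls the mass outside `[c - sL, c + sL]`. -/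
lemma measureReal_compl_Icc_le {G : Measure ℝ} [IsFiniteMeasure G] {c L s τ : ℝ}
    (hL : 0 < L) (hs : 0 < s) (hint : Integrable (fun y => (y - c) ^ 4) G)
    (hmom : ∫ y, (y - c) ^ 4 ∂G ≤ L ^ 4 * τ) :
    s ^ 4 * G.real (Set.Icc (c - s * L) (c + s * L))ᶜ ≤ τ := by
  have hsub : (Set.Icc (c - s * L) (c + s * L))ᶜ ⊆ {y | (s * L) ^ 4 ≤ (y - c) ^ 4} := by
    intro y hy
    have h1 : s * L ≤ |y - c| := by
      by_contra hcon
      rw [not_le, abs_lt] at hcon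
      exact hy ⟨by linarith [hcon.1], by linarith [hcon.2]⟩
    have h2 : (s * L) ^ 4 ≤ |y - c| ^ 4 := pow_le_pow_left₀ (by positivity) h1 4
    have h3 : |y - c| ^ 4 = (y - c) ^ 4 := (by decide : Even 4).pow_abs _
    simpa [h3] using h2
  have hM := mul_meas_ge_le_integral_of_nonneg (μ := G) (f := fun y => (y - c) ^ 4)
    (Filter.Eventually.of_forall fun y => by positivity) hint ((s * L) ^ 4)
  have h4 : (s * L) ^ 4 * G.real (Set.Icc (c - s * L) (c + s * L))ᶜ ≤ L ^ 4 * τ :=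
    (mul_le_mul_of_nonneg_left (measureReal_mono hsub) (by positivity)).trans (hM.trans hmom)
  have h5 : 0 < L ^ 4 := by positivity
  rw [mul_pow, mul_comm (s ^ 4), mul_assoc] at h4
  exact le_of_mul_le_mul_left h4 h5

/-- For a law with mean `c` and `E (y - c)⁴ ≤ L⁴ τ`, discarding the complement of `A` moves the
integral of `y - c` by at most `L (G(Aᶜ) + τ)`. -/
lemma abs_setIntegral_sub_mean_le {G : Measure ℝ} [IsProbabilityMeasure G] {c L τ : ℝ}
    (hL : 0 < L) (hid : Integrable (fun y => y) G) (hmean : ∫ y, y ∂G = c)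
    (hint : Integrable (fun y => (y - c) ^ 4) G)
    (hmom : ∫ y, (y - c) ^ 4 ∂G ≤ L ^ 4 * τ) {A : Set ℝ} (hA : MeasurableSet A) :
    |∫ y in A, (y - c) ∂G| ≤ L * (G.real Aᶜ + τ) := by
  have hi : Integrable (fun y => y - c) G := hid.sub (integrable_const c)
  have h0 : ∫ y, (y - c) ∂G = 0 := by
    rw [integral_sub hid (integrable_const c)]; simp [hmean]
  have h1 := integral_add_compl hA hi
  -- As `y - c` has mean zero, its integral over `A` is minus that over the complement, so only the
  -- tail matters.
  have h2 : |∫ y in A, (y - c) ∂G| = |∫ y in Aᶜ, (y - c) ∂G| := by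
    rw [show ∫ y in A, (y - c) ∂G = -∫ y in Aᶜ, (y - c) ∂G by linarith, abs_neg]
  have hpt : ∀ u : ℝ, |u| ≤ L + u ^ 4 / L ^ 3 := by
    intro u
    rcases le_total |u| L with h | h
    · have : 0 ≤ u ^ 4 / L ^ 3 := by positivity
      linarith
    · have h3 : |u| ≤ u ^ 4 / L ^ 3 := by
        rw [le_div_iff₀ (by positivity), ← (by decide : Even 4).pow_abs]
        have := mul_le_mul_of_nonneg_left (pow_le_pow_left₀ hL.le h 3) (abs_nonneg u)
        linarith [pow_succ' |u| 3]
      linarith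
  rw [h2]
  calc |∫ y in Aᶜ, (y - c) ∂G| ≤ ∫ y in Aᶜ, |y - c| ∂G := abs_integral_le_integral_abs
    _ ≤ ∫ y in Aᶜ, (L + (y - c) ^ 4 / L ^ 3) ∂G :=
        integral_mono hi.abs.integrableOn
          ((integrable_const L).add (hint.div_const (L ^ 3)).integrableOn) fun y => hpt _
    _ = L * G.real Aᶜ + (∫ y in Aᶜ, (y - c) ^ 4 ∂G) / L ^ 3 := by
        rw [integral_add (integrable_const L) (hint.div_const _).integrableOn, integral_div]
        simp [mul_comm]
    _ ≤ L * G.real Aᶜ + (L ^ 4 * τ) / L ^ 3 := by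
        gcongr
        exact (setIntegral_le_integral hint
          (Filter.Eventually.of_forall fun y => by positivity)).trans hmom
    _ = L * (G.real Aᶜ + τ) := by
        field_simp

/-! ### The empirical distribution of finitely many points -/

section Sample

variable {ι α : Type*} [MeasurableSpace α]

/-- Empirical distribution of the points `y i`, `i ∈ s`. -/
def sampleMeasure (y : ι → α) (s : Finset ι) : Measure α :=
  (s.card : ENNReal)⁻¹ • ∑ i ∈ s, Measure.dirac (y i)

instance (y : ι → α) (s : Finset ι) : IsFiniteMeasure (sampleMeasure y s) := by
  rcases s.eq_empty_or_nonempty with rfl | hs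
  · simp only [sampleMeasure, Finset.sum_empty, smul_zero]; infer_instance
  · constructor
    simp only [sampleMeasure, Measure.smul_apply, Measure.finsetSum_apply, smul_eq_mul]
    refine ENNReal.mul_lt_top (by simp [hs]) (by simp)

lemma sampleMeasure_real (y : ι → α) (s : Finset ι) {A : Set α} (hA : MeasurableSet A)
    [DecidablePred fun i => y i ∈ A] :
    (sampleMeasure y s).real A = ((s.filter fun i => y i ∈ A).card : ℝ) / s.card := by
  simp only [sampleMeasure, measureReal_def, Measure.smul_apply, Measure.finsetSum_apply,
    Measure.dirac_apply' _ hA, smul_eq_mul, ENNReal.toReal_mul, ENNReal.toReal_inv,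
    ENNReal.toReal_natCast, Finset.card_filter, Set.indicator, Pi.one_apply]
  rw [div_eq_inv_mul, ENNReal.toReal_sum (fun i _ => by split_ifs <;> simp)]
  push_cast
  congr 1
  exact Finset.sum_congr rfl fun i _ => by split_ifs <;> simp

instance (y : ι → α) (s : Finset ι) [Nonempty s] : IsProbabilityMeasure (sampleMeasure y s) := by
  have hs : s.Nonempty := Finset.nonempty_coe_sort.1 inferInstance
  constructor
  simp only [sampleMeasure, Measure.smul_apply, Measure.finsetSum_apply, smul_eq_mul]
  simp [ENNReal.inv_mul_cancel, hs.ne_empty]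

lemma setIntegral_sampleMeasure (y : ι → α) (s : Finset ι) {A : Set α} (hA : MeasurableSet A)
    [DecidablePred fun i => y i ∈ A] (f : α → ℝ) (hf : Measurable f) :
    ∫ x in A, f x ∂(sampleMeasure y s) = (∑ i ∈ s.filter (fun i => y i ∈ A), f (y i)) / s.card := by
  rw [← integral_indicator hA, sampleMeasure, integral_smul_measure, integral_finsetSum_measure]
  · rw [div_eq_inv_mul, Finset.sum_filter]
    rw [ENNReal.toReal_inv, ENNReal.toReal_natCast, smul_eq_mul]
    congr 1
    refine Finset.sum_congr rfl fun i _ => ?_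
    rw [integral_dirac' _ _ (hf.indicator hA).stronglyMeasurable, Set.indicator]
    split_ifs <;> rfl
  · exact fun i _ => integrable_dirac' (hf.indicator hA).stronglyMeasurable (by simp)

end Sample

/-! ### The agnostic mean on a representative sample -/

/-- The constant in the error bound of the agnostic mean at contamination level at most `η₀`. -/
def agnosticConst (η₀ : ℝ) : ℝ := (18 + 2 / ((1 - η₀) ^ 2 - η₀)) / (1 - η₀) ^ 2

lemma agnosticConst_pos {η₀ : ℝ} (hη₀ : η₀ < 1) (hbreak : η₀ < (1 - η₀) ^ 2) :
    0 < agnosticConst η₀ := by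
  have h1 : 0 < (1 - η₀) ^ 2 - η₀ := by linarith
  have h2 : 0 < 1 - η₀ := by linarith
  unfold agnosticConst
  positivity

/-- If an interval `[a, b]` of length at most `4L` has mass at least `q = (1 - η)(1 - η - ε)` under
`ν'`, and `ν'` agrees up to `e` on intervals with the Huber mixture `ν = (1 - η) G + η N`, then the
integral of `y - c` over `[a, b]` is `O(L (η + ε))`, where `c` is the mean of `G` and
`E_G (y - c)⁴ ≤ L⁴ (η + ε)`. -/
lemma abs_setIntegral_Icc_sub_le_of_huber {η₀ η ε e L c a b : ℝ} (hη₀ : η₀ < 1)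
    (hbreak : η₀ < (1 - η₀) ^ 2) (hη : 0 ≤ η) (hε : 0 < ε) (hηε : η + ε ≤ η₀) (he : e ≤ ε)
    (hL : 0 < L) {G N ν ν' : Measure ℝ} [IsProbabilityMeasure G] [IsProbabilityMeasure N]
    [IsFiniteMeasure ν] [IsFiniteMeasure ν']
    (hν : ν = ENNReal.ofReal (1 - η) • G + ENNReal.ofReal η • N)
    (hclose : ∀ a b, |ν'.real (Set.Icc a b) - ν.real (Set.Icc a b)| ≤ e)
    (hid : Integrable (fun y => y) G) (hmean : ∫ y, y ∂G = c)
    (hint : Integrable (fun y => (y - c) ^ 4) G)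
    (hmom : ∫ y, (y - c) ^ 4 ∂G ≤ L ^ 4 * (η + ε))
    (hab : a ≤ b) (hlen : b - a ≤ 4 * L)
    (hmass : (1 - η) * (1 - η - ε) ≤ ν'.real (Set.Icc a b)) :
    |∫ y in Set.Icc a b, (y - c) ∂ν'|
      ≤ (18 + 2 / ((1 - η₀) ^ 2 - η₀)) * (L * (η + ε)) := by
  set Δ := (1 - η₀) ^ 2 - η₀ with hΔdef
  have hΔ : 0 < Δ := by linarith
  set J := Set.Icc a b with hJ
  have hJm : MeasurableSet J := measurableSet_Icc
  set τ := η + ε with hτ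
  have hτ0 : 0 < τ := by linarith
  have hτ1 : τ < 1 := by linarith
  have h1η : 0 ≤ 1 - η := by linarith
  have hνreal : ∀ A, ν.real A = (1 - η) * G.real A + η * N.real A := by
    intro A
    rw [hν, measureReal_add_apply (by simp [ENNReal.mul_eq_top]) (by simp [ENNReal.mul_eq_top]),
      measureReal_ennreal_smul_apply, measureReal_ennreal_smul_apply,
      ENNReal.toReal_ofReal h1η, ENNReal.toReal_ofReal hη]
  -- Two lower bounds for the retained fraction: a constant one, which localizes the interval, and
  -- one with deficit `O(τ)`, which gives the rate.
  have hq : (1 - η₀) ^ 2 ≤ (1 - η) * (1 - η - ε) := by nlinarith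
  have hq' : 1 - 2 * τ ≤ (1 - η) * (1 - η - ε) := by nlinarith
  have hN1 : N.real J ≤ 1 := measureReal_le_one
  have hG1 : G.real J ≤ 1 := measureReal_le_one
  have hGJ : (1 - η) * (1 - η - ε) - e - η ≤ (1 - η) * G.real J := by
    have h1 := (abs_le.1 (hclose a b)).2
    rw [← hJ, hνreal] at h1
    have h2 : η * N.real J ≤ η := by nlinarith
    linarith
  have hGc : G.real Jᶜ = 1 - G.real J := probReal_compl_eq_one_sub hJm
  -- the interval meets the bulk of `G`
  set s := 1 + 1 / Δ with hs
  have hs0 : 0 < s := by positivity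
  obtain ⟨z, hzJ, hz⟩ : ∃ z ∈ J, z ∈ Set.Icc (c - s * L) (c + s * L) := by
    by_contra! hcon
    have h1 : G.real J ≤ G.real (Set.Icc (c - s * L) (c + s * L))ᶜ :=
      measureReal_mono fun z hz => hcon z hz
    have h2 := measureReal_compl_Icc_le hL hs0 hint hmom
    -- The breakdown condition enters here: `(1 - η₀)² - e - η ≥ (1 - η₀)² - η₀ = Δ`. If `J` missed
    -- the bulk, this mass would lie in the tail, whose mass is below `1 / s⁴ ≤ Δ`.
    have h3 : Δ ≤ G.real J := by nlinarith [measureReal_nonneg (μ := G) (s := J)]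
    have h4 : 1 ≤ Δ * s := by rw [hs]; field_simp; linarith
    have h5 : 1 ≤ s := by rw [hs]; linarith [show 0 < 1 / Δ by positivity]
    have h6 : s ≤ s ^ 4 := le_self_pow₀ h5 (by norm_num)
    nlinarith
  have hbound : ∀ y ∈ J, |y - c| ≤ (s + 4) * L := by
    intro y hy
    rw [abs_le]
    constructor <;> linarith [hy.1, hy.2, hzJ.1, hzJ.2, hz.1, hz.2]
  have e1 : |∫ y in J, (y - c) ∂ν' - ∫ y in J, (y - c) ∂ν| ≤ τ * ((s + 8) * L) := by
    have he0 : 0 ≤ e := (abs_nonneg _).trans (hclose a b)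
    refine (abs_setIntegral_Icc_sub_le hclose hab c).trans ?_
    have := hbound a ⟨le_rfl, hab⟩
    exact mul_le_mul (by linarith) (by linarith)
      (by linarith [abs_nonneg (a - c)]) hτ0.le
  have e2 : ∫ y in J, (y - c) ∂ν
      = (1 - η) * ∫ y in J, (y - c) ∂G + η * ∫ y in J, (y - c) ∂N := by
    rw [hν, Measure.restrict_add, integral_add_measure, Measure.restrict_smul,
      Measure.restrict_smul, integral_smul_measure, integral_smul_measure,
      ENNReal.toReal_ofReal h1η, ENNReal.toReal_ofReal hη, smul_eq_mul, smul_eq_mul]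
    · rw [Measure.restrict_smul]
      exact (integrableOn_Icc_sub G a b c).smul_measure (by simp)
    · rw [Measure.restrict_smul]
      exact (integrableOn_Icc_sub N a b c).smul_measure (by simp)
  have e3 : |∫ y in J, (y - c) ∂N| ≤ (s + 4) * L := by
    have h1 := norm_setIntegral_le_of_norm_le_const (μ := N) (s := J) (C := (s + 4) * L)
      (f := fun y => y - c) (by simp) hbound
    rw [Real.norm_eq_abs] at h1
    have h2 : 0 ≤ (s + 4) * L := by positivity
    nlinarith
  have e4 := abs_setIntegral_sub_mean_le hL hid hmean hint hmom hJm
  -- Clean mass lost: `(1 - η) G(Jᶜ) ≤ 2τ + e ≤ 3τ`; the moment term adds one more `τ`.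
  have e5 : (1 - η) * |∫ y in J, (y - c) ∂G| ≤ L * (4 * τ) := by
    have h1 : (1 - η) * (G.real Jᶜ + τ) ≤ 4 * τ := by rw [hGc]; nlinarith
    calc _ ≤ (1 - η) * (L * (G.real Jᶜ + τ)) := mul_le_mul_of_nonneg_left e4 h1η
      _ = L * ((1 - η) * (G.real Jᶜ + τ)) := by ring
      _ ≤ _ := mul_le_mul_of_nonneg_left h1 hL.le
  have e6 : η * |∫ y in J, (y - c) ∂N| ≤ τ * ((s + 4) * L) :=
    mul_le_mul (by linarith) e3 (abs_nonneg _) hτ0.le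
  have e7 : |∫ y in J, (y - c) ∂ν| ≤ L * (4 * τ) + τ * ((s + 4) * L) := by
    rw [e2]
    refine (abs_add_le _ _).trans ?_
    rw [abs_mul, abs_mul, abs_of_nonneg h1η, abs_of_nonneg hη]
    exact add_le_add e5 e6
  have e8 : |∫ y in J, (y - c) ∂ν'| ≤ τ * ((s + 8) * L) + (L * (4 * τ) + τ * ((s + 4) * L)) := by
    have := abs_sub_abs_le_abs_sub (∫ y in J, (y - c) ∂ν') (∫ y in J, (y - c) ∂ν)
    linarith
  -- The coefficients add up to `(s + 8) + 4 + (s + 4) = 2s + 16 = 18 + 2 / Δ`.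
  refine e8.trans (le_of_eq ?_)
  rw [hs]; ring

/-- Error of the agnostic mean when the empirical distribution of the sample is uniformly close on
intervals to the contaminated law. -/
lemma IsAgnosticMean.abs_sub_le {ι : Type*} {y : ι → ℝ} {t : Finset ι} {m : ℝ}
    {η₀ η ε e L c : ℝ} (hη₀ : η₀ < 1)
    (hbreak : η₀ < (1 - η₀) ^ 2) (hη : 0 ≤ η) (hε : 0 < ε) (hηε : η + ε ≤ η₀)
    (he : e ≤ (1 - η₀) / 2 * ε) (hL : 0 < L) {G N ν : Measure ℝ} [IsProbabilityMeasure G]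
    [IsProbabilityMeasure N] [IsFiniteMeasure ν]
    (hν : ν = ENNReal.ofReal (1 - η) • G + ENNReal.ofReal η • N)
    (ht : t.Nonempty)
    (hclose : ∀ a b, |(sampleMeasure y t).real (Set.Icc a b) - ν.real (Set.Icc a b)| ≤ e)
    (hid : Integrable (fun y => y) G) (hmean : ∫ y, y ∂G = c)
    (hint : Integrable (fun y => (y - c) ^ 4) G)
    (hmom : ∫ y, (y - c) ^ 4 ∂G ≤ L ^ 4 * (η + ε))
    (hm : IsAgnosticMean η ε y t m) :
    |m - c| ≤ agnosticConst η₀ * (L * (η + ε)) := by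
  classical
  obtain ⟨a, b, ⟨hab, hmass, hshort⟩, rfl⟩ := hm
  have hcard : (0 : ℝ) < t.card := by exact_mod_cast ht.card_pos
  have hreal : ∀ a b : ℝ, (sampleMeasure y t).real (Set.Icc a b)
      = ((t.filter fun i => a ≤ y i ∧ y i ≤ b).card : ℝ) / t.card := by
    intro a b
    rw [sampleMeasure_real y t measurableSet_Icc]
    rfl
  have hle : ∀ q a b : ℝ, q * (t.card : ℝ) ≤ ((t.filter fun i => a ≤ y i ∧ y i ≤ b).card : ℝ)
      ↔ q ≤ (sampleMeasure y t).real (Set.Icc a b) := by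
    intro q a b
    rw [hreal, le_div_iff₀ hcard]
  simp only [hle] at hmass hshort
  have hνreal : (1 - η) * G.real (Set.Icc (c - 2 * L) (c + 2 * L))
      ≤ ν.real (Set.Icc (c - 2 * L) (c + 2 * L)) := by
    rw [hν, measureReal_add_apply (by simp [ENNReal.mul_eq_top]) (by simp [ENNReal.mul_eq_top]),
      measureReal_ennreal_smul_apply, measureReal_ennreal_smul_apply,
      ENNReal.toReal_ofReal (by linarith), ENNReal.toReal_ofReal hη]
    have := mul_nonneg hη (measureReal_nonneg (μ := N) (s := Set.Icc (c - 2 * L) (c + 2 * L)))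
    linarith
  have htail := measureReal_compl_Icc_le hL two_pos hint hmom
  rw [probReal_compl_eq_one_sub measurableSet_Icc] at htail
  -- The interval of radius `2L` around `c` is a competitor: Markov loses at most `τ / 16` of the
  -- clean mass, and `e ≤ (1 - η) τ / 2` fits in the remaining slack `(1 - η) (15 / 16) τ`.
  have hlen : b - a ≤ 4 * L := by
    have := hshort (c - 2 * L) (c + 2 * L) (by linarith) ?_
    · linarith
    · have h1 := (abs_le.1 (hclose (c - 2 * L) (c + 2 * L))).1
      have h2 : (1 - η) * (1 - (η + ε) / 16) ≤ (1 - η) * G.real (Set.Icc (c - 2 * L) (c + 2 * L)) :=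
        mul_le_mul_of_nonneg_left (by linarith) (by linarith)
      have h3 : (1 - η₀) / 2 * ε ≤ (1 - η) / 2 * (η + ε) :=
        mul_le_mul (by linarith) (by linarith) hε.le (by linarith)
      nlinarith
  have hmain := abs_setIntegral_Icc_sub_le_of_huber hη₀ hbreak hη hε hηε
    (by nlinarith) hL hν hclose hid hmean hint hmom hab hlen hmass
  set F := t.filter fun i => a ≤ y i ∧ y i ≤ b with hF
  have hq : (1 - η₀) ^ 2 ≤ (1 - η) * (1 - η - ε) := by nlinarith
  have hq0 : 0 < (1 - η₀) ^ 2 := by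
    have : 0 < 1 - η₀ := by linarith
    positivity
  have hFm : (1 - η₀) ^ 2 ≤ (F.card : ℝ) / t.card := by
    rw [← hreal]; exact hq.trans hmass
  have hF0 : (0 : ℝ) < F.card := by
    by_contra hcon
    have : (F.card : ℝ) = 0 := le_antisymm (not_lt.1 hcon) (by positivity)
    rw [this, zero_div] at hFm
    linarith
  rw [setIntegral_sampleMeasure y t measurableSet_Icc (fun z => z - c)
    (measurable_id.sub_const c)] at hmain
  have hFeq : t.filter (fun i => y i ∈ Set.Icc a b) = F := rfl
  rw [hFeq, Finset.sum_sub_distrib, Finset.sum_const, nsmul_eq_mul] at hmain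
  have hid : ((∑ i ∈ F, y i) - F.card * c) / t.card
      = ((F.card : ℝ) / t.card) * ((∑ i ∈ F, y i) / F.card - c) := by
    field_simp
  rw [hid, abs_mul, abs_of_pos (by positivity)] at hmain
  rw [agnosticConst, div_mul_eq_mul_div, le_div_iff₀ hq0, mul_comm]
  exact (mul_le_mul_of_nonneg_right hFm (abs_nonneg _)).trans hmain

/-- The error bound in terms of a fourth moment bound `E_G (y - c)⁴ ≤ B⁴`. -/
lemma IsAgnosticMean.abs_sub_le_rpow {ι : Type*} {y : ι → ℝ} {t : Finset ι} {m : ℝ}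
    {η₀ η ε e B c : ℝ} (hη₀ : η₀ < 1)
    (hbreak : η₀ < (1 - η₀) ^ 2) (hη : 0 ≤ η) (hε : 0 < ε) (hηε : η + ε ≤ η₀)
    (he : e ≤ (1 - η₀) / 2 * ε) (hB : 0 ≤ B) {G N ν : Measure ℝ} [IsProbabilityMeasure G]
    [IsProbabilityMeasure N] [IsFiniteMeasure ν]
    (hν : ν = ENNReal.ofReal (1 - η) • G + ENNReal.ofReal η • N)
    (ht : t.Nonempty)
    (hclose : ∀ a b, |(sampleMeasure y t).real (Set.Icc a b) - ν.real (Set.Icc a b)| ≤ e)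
    (hmem : MemLp (fun y : ℝ => y) 4 G) (hmean : ∫ y, y ∂G = c)
    (hmom : ∫ y, (y - c) ^ 4 ∂G ≤ B ^ 4)
    (hm : IsAgnosticMean η ε y t m) :
    |m - c| ≤ agnosticConst η₀ * (B * (η + ε) ^ (3 / 4 : ℝ)) := by
  have hK := agnosticConst_pos hη₀ hbreak
  have hτ : 0 < η + ε := by linarith
  have hid : Integrable (fun y => y) G := hmem.integrable (by norm_num)
  have hint : Integrable (fun y => (y - c) ^ 4) G := by
    have h1 : MemLp (fun y : ℝ => y - c) (4 : ℕ) G := by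
      exact_mod_cast hmem.sub (memLp_const c)
    refine (h1.integrable_norm_pow (by norm_num)).congr (Filter.Eventually.of_forall fun y => ?_)
    exact (by decide : Even 4).pow_abs _
  -- The scale `L` must be positive while `B` may vanish, so the bound is proved for all `B' > B`
  -- and passed to the limit.
  have key : ∀ B' : ℝ, B < B' →
      |m - c| ≤ agnosticConst η₀ * (B' * (η + ε) ^ (3 / 4 : ℝ)) := by
    intro B' hB'
    have hB0 : 0 < B' := hB.trans_lt hB'
    have hpow : ((η + ε) ^ (-(1 / 4) : ℝ)) ^ 4 * (η + ε) = 1 := by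
      rw [← Real.rpow_natCast, ← Real.rpow_mul hτ.le]
      norm_num
      rw [Real.rpow_neg_one, inv_mul_cancel₀ hτ.ne']
    have h := IsAgnosticMean.abs_sub_le (L := B' * (η + ε) ^ (-(1 / 4) : ℝ)) hη₀ hbreak hη hε hηε
      he (by positivity) hν ht hclose hid hmean hint
      (by
        rw [mul_pow, mul_assoc, hpow, mul_one]
        exact hmom.trans (pow_le_pow_left₀ hB hB'.le 4)) hm
    have h34 : (η + ε) ^ (-(1 / 4) : ℝ) * (η + ε) = (η + ε) ^ (3 / 4 : ℝ) := by
      nth_rewrite 2 [← Real.rpow_one (η + ε)]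
      rw [← Real.rpow_add hτ]
      norm_num
    rwa [mul_assoc, h34] at h
  have hcont : Continuous fun B' : ℝ => agnosticConst η₀ * (B' * (η + ε) ^ (3 / 4 : ℝ)) := by
    fun_prop
  refine ge_of_tendsto (hcont.continuousWithinAt (s := Set.Ioi B) (x := B)) ?_
  filter_upwards [self_mem_nhdsWithin] with B' hB' using key B' hB'

/-! ### Uniform deviation on intervals from finitely many quantiles -/

lemma tendsto_measureReal_Iic (ν : Measure ℝ) [IsFiniteMeasure ν] {u : ℕ → ℝ} {a : ℝ}
    (hu : StrictMono u) (hlt : ∀ k, u k < a)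
    (hlim : Filter.Tendsto u Filter.atTop (nhds a)) :
    Filter.Tendsto (fun k => ν.real (Set.Iic (u k))) Filter.atTop (nhds (ν.real (Set.Iio a))) := by
  have ht := tendsto_measure_iUnion_atTop (μ := ν) (s := fun k => Set.Iic (u k))
    fun i j hij => Set.Iic_subset_Iic.2 (hu.monotone hij)
  rw [iUnion_Iic_eq_Iio_of_lt_of_tendsto hlt hlim] at ht
  exact (ENNReal.tendsto_toReal (measure_ne_top ν _)).comp ht

/-- Quantiles: the superlevel set of the distribution function is a closed half-line `[q, ∞)`. -/
lemma exists_quantile (ν : Measure ℝ) [IsProbabilityMeasure ν] {r : ℝ} (h0 : 0 < r) (h1 : r < 1) :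
    ∃ q : ℝ, (∀ y, r ≤ ν.real (Set.Iic y) ↔ q ≤ y) ∧ ν.real (Set.Iio q) ≤ r := by
  set S : Set ℝ := {y | r ≤ cdf ν y} with hS
  have hne : S.Nonempty := by
    obtain ⟨y, hy⟩ := ((tendsto_cdf_atTop ν).eventually (eventually_gt_nhds h1)).exists
    exact ⟨y, hy.le⟩
  have hbdd : BddBelow S := by
    obtain ⟨y, hy⟩ := ((tendsto_cdf_atBot ν).eventually (eventually_lt_nhds h0)).exists
    refine ⟨y, fun z hz => ?_⟩
    by_contra hcon
    have := monotone_cdf ν (not_le.1 hcon).le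
    exact absurd (hz.trans this) (not_le.2 hy)
  -- Right continuity of the distribution function makes the infimum a minimum.
  have hmem : r ≤ cdf ν (sInf S) := by
    have hc : Filter.Tendsto (cdf ν) (nhdsWithin (sInf S) (Set.Ioi (sInf S)))
        (nhds (cdf ν (sInf S))) :=
      ((cdf ν).right_continuous (sInf S)).mono_left (nhdsWithin_mono _ Set.Ioi_subset_Ici_self)
    refine ge_of_tendsto hc ?_
    filter_upwards [self_mem_nhdsWithin] with y hy
    obtain ⟨z, hz, hzy⟩ := exists_lt_of_csInf_lt hne hy
    exact le_trans hz (monotone_cdf ν hzy.le)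
  have hiff : ∀ y, r ≤ ν.real (Set.Iic y) ↔ sInf S ≤ y := by
    intro y
    rw [← cdf_eq_real]
    exact ⟨fun h => csInf_le hbdd h, fun h => hmem.trans (monotone_cdf ν h)⟩
  refine ⟨sInf S, hiff, ?_⟩
  obtain ⟨u, hu, hlt, hlim⟩ := exists_seq_strictMono_tendsto (sInf S)
  refine le_of_tendsto (tendsto_measureReal_Iic ν hu hlt hlim) (Filter.Eventually.of_forall fun k => ?_)
  by_contra hcon
  exact absurd ((hiff (u k)).1 (not_le.1 hcon).le) (not_le.2 (hlt k))

lemma measureReal_Icc (ν : Measure ℝ) [IsFiniteMeasure ν] {a b : ℝ} (hab : a ≤ b) :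
    ν.real (Set.Icc a b) = ν.real (Set.Iic b) - ν.real (Set.Iio a) := by
  have h : Set.Icc a b = Set.Iic b \ Set.Iio a := by
    ext y
    simp
  rw [h, measureReal_sdiff (Set.Iio_subset_Iic hab) measurableSet_Iio]

/-- A finite set of quantiles of `ν` at which a scaled law `p' ν'` has to be compared with `p ν` in
order to compare them on all closed intervals. -/
lemma exists_grid (ν : Measure ℝ) [IsProbabilityMeasure ν] {m : ℕ} (hm : 0 < m) :
    ∃ q : Fin m → ℝ, ∀ (ν' : Measure ℝ) [IsProbabilityMeasure ν'] (p p' e : ℝ), 0 ≤ p → 0 ≤ p' →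
      |p' - p| ≤ e →
      (∀ j, |p' * ν'.real (Set.Iic (q j)) - p * ν.real (Set.Iic (q j))| ≤ e) →
      (∀ j, |p' * ν'.real (Set.Iio (q j)) - p * ν.real (Set.Iio (q j))| ≤ e) →
      ∀ a b, |p' * ν'.real (Set.Icc a b) - p * ν.real (Set.Icc a b)| ≤ 2 * (e + p / m) := by
  have hm0 : (0 : ℝ) < m := by exact_mod_cast hm
  -- Level `0` has no quantile; the grid point there is a dummy.
  have hex : ∀ j : Fin m, ∃ q : ℝ, 0 < (j : ℕ) →
      (∀ y, (j : ℝ) / m ≤ ν.real (Set.Iic y) ↔ q ≤ y) ∧ ν.real (Set.Iio q) ≤ (j : ℝ) / m := by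
    intro j
    by_cases hj : 0 < (j : ℕ)
    · have h1 : (0 : ℝ) < (j : ℕ) := by exact_mod_cast hj
      have h2 : ((j : ℕ) : ℝ) < m := by exact_mod_cast j.2
      obtain ⟨q, hq⟩ := exists_quantile ν (r := (j : ℝ) / m) (by positivity)
        ((div_lt_one hm0).2 h2)
      exact ⟨q, fun _ => hq⟩
    · exact ⟨0, fun h => absurd h hj⟩
  choose q hq using hex
  refine ⟨q, fun ν' _ p p' e hp hp' hpp hIic hIio => ?_⟩
  have he : 0 ≤ e := (abs_nonneg _).trans hpp
  have hcdf : ∀ y, |p' * ν'.real (Set.Iic y) - p * ν.real (Set.Iic y)| ≤ e + p / m := by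
    intro y
    set F := ν.real (Set.Iic y) with hF
    have hF0 : 0 ≤ F := measureReal_nonneg
    have hF1 : F ≤ 1 := measureReal_le_one
    set j := ⌊(m : ℝ) * F⌋₊ with hj
    have hj1 : (j : ℝ) ≤ m * F := Nat.floor_le (by positivity)
    have hj2 : (m : ℝ) * F < j + 1 := Nat.lt_floor_add_one _
    have hjd : F < ((j + 1 : ℕ) : ℝ) / m := by
      rw [lt_div_iff₀ hm0]; push_cast; linarith
    have hjF : p * ((j + 1 : ℕ) : ℝ) / m ≤ p * F + p / m := by
      have : (j : ℝ) / m ≤ F := by rw [div_le_iff₀ hm0]; linarith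
      have := mul_le_mul_of_nonneg_left this hp
      push_cast
      rw [mul_add, mul_one, add_div, mul_div_assoc]
      linarith
    have hν'1 : ν'.real (Set.Iic y) ≤ 1 := measureReal_le_one
    rw [abs_le]
    constructor
    · -- lower bound by the quantile below `y`
      -- When `F = 1` the floor is `m`, one past the last grid index.
      set i := min j (m - 1) with hi
      have him : i < m := by omega
      have hiF : (i : ℝ) / m ≤ F := by
        have : (i : ℝ) ≤ j := by exact_mod_cast min_le_left _ _
        rw [div_le_iff₀ hm0]; linarith
      have hFi : p * F ≤ p * ((i : ℝ) / m) + p / m := by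
        have h1 : F ≤ ((i + 1 : ℕ) : ℝ) / m := by
          rcases min_choice j (m - 1) with h | h
          · rw [hi, h]; exact hjd.le
          · rw [hi, h, Nat.sub_add_cancel hm, div_self hm0.ne']; exact hF1
        have := mul_le_mul_of_nonneg_left h1 hp
        push_cast at this
        rwa [add_div, mul_add, mul_one_div] at this
      -- Below the first level `p F ≤ p / m`, so nonnegativity of the other mass suffices.
      rcases Nat.eq_zero_or_pos i with h0 | h0
      · have h1 : 0 ≤ p' * ν'.real (Set.Iic y) := by positivity
        rw [h0] at hFi
        simp only [Nat.cast_zero, zero_div, mul_zero, zero_add] at hFi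
        linarith
      · have h1 := hq ⟨i, him⟩ h0
        have h3 : q ⟨i, him⟩ ≤ y := (h1.1 y).1 hiF
        have h4 := (h1.1 _).2 le_rfl
        have h5 : p' * ν'.real (Set.Iic (q ⟨i, him⟩)) ≤ p' * ν'.real (Set.Iic y) :=
          mul_le_mul_of_nonneg_left (measureReal_mono (Set.Iic_subset_Iic.2 h3)) hp'
        have h6 := (abs_le.1 (hIic ⟨i, him⟩)).1
        have h7 := mul_le_mul_of_nonneg_left h4 hp
        simp only at h7
        linarith
    -- The next quantile lies strictly above `y`. Comparing open half-lines there avoids counting a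
    -- possible atom at the quantile. Past the last level the total masses are compared instead.
    · rcases lt_or_ge (j + 1) m with hjm | hjm
      · have h1 := hq ⟨j + 1, hjm⟩ (Nat.succ_pos j)
        have h3 : y < q ⟨j + 1, hjm⟩ := by
          by_contra hcon
          exact absurd ((h1.1 y).2 (not_lt.1 hcon)) (not_le.2 hjd)
        have h5 : p' * ν'.real (Set.Iic y) ≤ p' * ν'.real (Set.Iio (q ⟨j + 1, hjm⟩)) :=
          mul_le_mul_of_nonneg_left (measureReal_mono (Set.Iic_subset_Iio.2 h3)) hp'
        have h6 := (abs_le.1 (hIio ⟨j + 1, hjm⟩)).2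
        have h7 := mul_le_mul_of_nonneg_left h1.2 hp
        simp only at h7
        rw [mul_div_assoc] at hjF
        linarith
      · have h1 : p ≤ p * ((j + 1 : ℕ) : ℝ) / m := by
          rw [le_div_iff₀ hm0]
          exact mul_le_mul_of_nonneg_left (by exact_mod_cast hjm) hp
        have h2 := (abs_le.1 hpp).2
        have h3 : p' * ν'.real (Set.Iic y) ≤ p' := mul_le_of_le_one_right hp' hν'1
        linarith
  have hIio' : ∀ a, |p' * ν'.real (Set.Iio a) - p * ν.real (Set.Iio a)| ≤ e + p / m := by
    intro a
    obtain ⟨u, hu, hlt, hlim⟩ := exists_seq_strictMono_tendsto a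
    exact le_of_tendsto (((tendsto_measureReal_Iic ν' hu hlt hlim).const_mul p').sub
      ((tendsto_measureReal_Iic ν hu hlt hlim).const_mul p)).abs
      (Filter.Eventually.of_forall fun k => hcdf _)
  intro a b
  rcases le_or_gt a b with hab | hab
  · rw [measureReal_Icc ν hab, measureReal_Icc ν' hab]
    have h1 := abs_le.1 (hcdf b)
    have h2 := abs_le.1 (hIio' a)
    rw [abs_le]
    constructor <;> nlinarith
  · rw [Set.Icc_eq_empty (not_le.2 hab)]
    simp only [measureReal_empty, mul_zero, sub_self, abs_zero]
    positivity

/-! ### Concentration of empirical frequencies -/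

/-- Hoeffding's inequality for the frequency of an event in an i.i.d. sample. -/
lemma measureReal_frequency_deviation_le {α Ω : Type*} [MeasurableSpace α] [MeasurableSpace Ω]
    {Pr : Measure Ω} [IsProbabilityMeasure Pr] {n : ℕ} (hn : 0 < n) {X : Fin n → Ω → α}
    {μ : Measure α} (hX : ∀ i, Measurable (X i)) (hind : iIndepFun X Pr)
    (hlaw : ∀ i, Pr.map (X i) = μ) {A : Set α} (hA : MeasurableSet A)
    {e : ℝ} (he : 0 ≤ e) :
    Pr.real {ω | e ≤ |(∑ i, A.indicator (fun _ => (1 : ℝ)) (X i ω)) / n - μ.real A|}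
      ≤ 2 * Real.exp (-(2 * e ^ 2) * n) := by
  have hn0 : (0 : ℝ) < n := by exact_mod_cast hn
  set f : α → ℝ := A.indicator fun _ => (1 : ℝ) with hf
  have hfm : Measurable f := measurable_const.indicator hA
  have hmean : ∀ i, ∫ ω, f (X i ω) ∂Pr = μ.real A := by
    intro i
    rw [← integral_map (hX i).aemeasurable hfm.aestronglyMeasurable, hlaw i, hf,
      integral_indicator hA]
    simp
  -- Hoeffding's lemma: a variable in `[0, 1]` has variance proxy `1 / 4`, whence the exponent `-2
  -- e² n`.
  have hsub : ∀ i, HasSubgaussianMGF (fun ω => f (X i ω) - μ.real A) ((‖(1 : ℝ) - 0‖₊ / 2) ^ 2)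
      Pr := by
    intro i
    have := hasSubgaussianMGF_of_mem_Icc (μ := Pr) (X := fun ω => f (X i ω)) (a := 0) (b := 1)
      (hfm.comp (hX i)).aemeasurable (Filter.Eventually.of_forall fun ω => by
        simp only [hf, Set.indicator]; split_ifs <;> simp)
    rwa [hmean i] at this
  have hindf : iIndepFun (fun i ω => f (X i ω) - μ.real A) Pr :=
    hind.comp (fun _ x => f x - μ.real A) fun _ => hfm.sub_const _
  have hindf' : iIndepFun (fun i ω => -(f (X i ω) - μ.real A)) Pr :=
    hind.comp (fun _ x => -(f x - μ.real A)) fun _ => (hfm.sub_const _).neg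
  have b1 := HasSubgaussianMGF.measure_sum_ge_le_of_iIndepFun hindf (s := Finset.univ)
    (fun i _ => hsub i) (ε := n * e) (by positivity)
  have b2 := HasSubgaussianMGF.measure_sum_ge_le_of_iIndepFun hindf' (s := Finset.univ)
    (fun i _ => (hsub i).neg) (ε := n * e) (by positivity)
  have hexp : -((n : ℝ) * e) ^ 2 / (2 * ((∑ _i : Fin n, (‖(1 : ℝ) - 0‖₊ / 2) ^ 2 : NNReal) : ℝ))
      = -(2 * e ^ 2) * n := by
    simp
    field_simp
  have hcov : {ω | e ≤ |(∑ i, f (X i ω)) / n - μ.real A|}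
      ⊆ {ω | n * e ≤ ∑ i, (f (X i ω) - μ.real A)}
        ∪ {ω | n * e ≤ ∑ i, -(f (X i ω) - μ.real A)} := by
    intro ω hω
    have hsum : ∑ i, (f (X i ω) - μ.real A) = n * ((∑ i, f (X i ω)) / n - μ.real A) := by
      rw [Finset.sum_sub_distrib]
      simp
      field_simp
    rw [Set.mem_ofPred_eq] at hω
    rcases le_abs.1 hω with h | h
    · left
      rw [Set.mem_ofPred_eq, hsum]
      exact mul_le_mul_of_nonneg_left h hn0.le
    · right
      rw [Set.mem_ofPred_eq, Finset.sum_neg_distrib, hsum, ← mul_neg]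
      exact mul_le_mul_of_nonneg_left h hn0.le
  calc _ ≤ _ := measureReal_mono hcov
    _ ≤ _ := measureReal_union_le _ _
    _ ≤ _ := add_le_add b1 b2
    _ = _ := by
      push_cast at hexp ⊢
      rw [hexp]; ring

/-- With high probability the frequencies of finitely many events are all close to their
probabilities. -/
lemma exists_good_event {α Ω κ : Type*} [MeasurableSpace α] [MeasurableSpace Ω] [Fintype κ]
    {Pr : Measure Ω} [IsProbabilityMeasure Pr] {n : ℕ} (hn : 0 < n) {X : Fin n → Ω → α}
    {μ : Measure α} (hX : ∀ i, Measurable (X i)) (hind : iIndepFun X Pr)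
    (hlaw : ∀ i, Pr.map (X i) = μ) {A : κ → Set α} (hA : ∀ c, MeasurableSet (A c))
    {e : ℝ} (he : 0 ≤ e) :
    ∃ G : Set Ω, MeasurableSet G ∧
      1 - Fintype.card κ * (2 * Real.exp (-(2 * e ^ 2) * n)) ≤ Pr.real G ∧
      ∀ ω ∈ G, ∀ c,
        |(∑ i, (A c).indicator (fun _ => (1 : ℝ)) (X i ω)) / n - μ.real (A c)| ≤ e := by
  set D : κ → Set Ω := fun c =>
    {ω | e ≤ |(∑ i, (A c).indicator (fun _ => (1 : ℝ)) (X i ω)) / n - μ.real (A c)|} with hD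
  have hDm : ∀ c, MeasurableSet (D c) := by
    intro c
    have hm : Measurable fun ω =>
        |(∑ i, (A c).indicator (fun _ => (1 : ℝ)) (X i ω)) / n - μ.real (A c)| := by
      have h1 : ∀ i, Measurable fun ω => (A c).indicator (fun _ => (1 : ℝ)) (X i ω) := fun i =>
        (measurable_const.indicator (hA c)).comp (hX i)
      have h2 := Finset.measurable_fun_sum Finset.univ fun i _ => h1 i
      exact ((h2.div_const _).sub_const _).abs
    exact measurableSet_le measurable_const hm
  refine ⟨(⋃ c, D c)ᶜ, (MeasurableSet.iUnion hDm).compl, ?_, fun ω hω c => ?_⟩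
  · rw [probReal_compl_eq_one_sub (MeasurableSet.iUnion hDm)]
    have h1 : Pr.real (⋃ c, D c) ≤ ∑ c, Pr.real (D c) := measureReal_iUnion_fintype_le _
    have h2 : ∑ c, Pr.real (D c) ≤ ∑ _c : κ, 2 * Real.exp (-(2 * e ^ 2) * n) :=
      Finset.sum_le_sum fun c _ => measureReal_frequency_deviation_le hn hX hind hlaw (hA c) he
    simp only [Finset.sum_const, Finset.card_univ, nsmul_eq_mul] at h2
    linarith
  · by_contra hcon
    exact hω (Set.mem_iUnion.2 ⟨c, (not_le.1 hcon).le⟩)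

/-- Exponentially small failure probabilities are eventually below `n⁻ᵏ`. -/
lemma exists_forall_mul_exp_le (M : ℝ) {c : ℝ} (hc : 0 < c) (k : ℕ) :
    ∃ n₀ : ℕ, 0 < n₀ ∧ ∀ n : ℕ, n₀ ≤ n → M * (2 * Real.exp (-c * n)) ≤ 1 / (n : ℝ) ^ k := by
  have h1 : Filter.Tendsto (fun n : ℕ => c * (n : ℝ)) Filter.atTop Filter.atTop :=
    tendsto_natCast_atTop_atTop.const_mul_atTop hc
  have h2 := ((Real.tendsto_pow_mul_exp_neg_atTop_nhds_zero k).comp h1).const_mul (2 * M / c ^ k)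
  rw [mul_zero] at h2
  obtain ⟨n₁, hn₁⟩ := Filter.eventually_atTop.1 (h2.eventually (eventually_lt_nhds one_pos))
  refine ⟨n₁ + 1, Nat.succ_pos _, fun n hn => ?_⟩
  have h3 := hn₁ n (by omega)
  have hn0 : (0 : ℝ) < n := by exact_mod_cast (by omega : 0 < n)
  rw [le_div_iff₀ (by positivity)]
  refine le_trans (le_of_eq ?_) h3.le
  simp only [Function.comp_apply, mul_pow]
  rw [neg_mul]
  field_simp

/-! ### Cells -/

section Cells

variable {W : Type*}

lemma evT_inter_fst (w : W) (t : Bool) : evT t ∩ {x : Obs W | x.1 = w} = evWT w t := by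
  ext x
  simp [evT, evWT, and_comm]

variable [MeasurableSpace W]

lemma measurableSet_evT (t : Bool) : MeasurableSet (evT t : Set (Obs W)) :=
  (measurable_fst.comp measurable_snd) (measurableSet_singleton t)

lemma measurable_outcome : Measurable fun x : Obs W => x.2.2 :=
  measurable_snd.comp measurable_snd

lemma isProbabilityMeasure_condY {μ : Measure (Obs W)} [IsFiniteMeasure μ] {w : W} {t : Bool}
    (h : μ (evWT w t) ≠ 0) : IsProbabilityMeasure (condY μ w t) := by
  have := cond_isProbabilityMeasure h
  exact Measure.isProbabilityMeasure_map measurable_outcome.aemeasurable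

lemma condW_eq_div (μ : Measure (Obs W)) (t : Bool) (w : W) :
    condW μ t w = μ.real (evWT w t) / μ.real (evT t) := by
  rw [condW, measureReal_def, cond_apply (measurableSet_evT t), evT_inter_fst, ENNReal.toReal_mul,
    ENNReal.toReal_inv, div_eq_inv_mul]
  rfl

variable [MeasurableSingletonClass W]

lemma measurableSet_fst (w : W) : MeasurableSet {x : Obs W | x.1 = w} :=
  measurable_fst (measurableSet_singleton w)

lemma measurableSet_evWT (w : W) (t : Bool) : MeasurableSet (evWT w t : Set (Obs W)) := by
  rw [← evT_inter_fst]
  exact (measurableSet_evT t).inter (measurableSet_fst w)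

/-- This replaces conditional laws by joint probabilities, so concentration is applied to the full
sample of fixed size and never to the random number of records in a cell. -/
lemma measureReal_evWT_mul_condY (μ : Measure (Obs W)) [IsFiniteMeasure μ] (w : W) (t : Bool)
    {A : Set ℝ} (hA : MeasurableSet A) :
    μ.real (evWT w t ∩ {x | x.2.2 ∈ A}) = μ.real (evWT w t) * (condY μ w t).real A := by
  rw [condY, map_measureReal_apply measurable_outcome hA, measureReal_def, measureReal_def,
    measureReal_def, ← ENNReal.toReal_mul, mul_comm, cond_mul_eq_inter (measurableSet_evWT w t)]
  rfl

variable [Fintype W]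

lemma measureReal_evT (μ : Measure (Obs W)) [IsFiniteMeasure μ] (t : Bool) :
    μ.real (evT t) = ∑ w, μ.real (evWT w t) := by
  have h : (evT t : Set (Obs W)) = ⋃ w, evWT w t := by
    ext x
    simp [evT, evWT]
  rw [h, measureReal_iUnion_fintype _ (fun w => measurableSet_evWT w t)]
  intro w w' hww
  refine Set.disjoint_left.2 fun x hx hx' => hww ?_
  exact hx.1.symm.trans hx'.1

lemma sum_condW {μ : Measure (Obs W)} [IsFiniteMeasure μ] {t : Bool} (h : μ (evT t) ≠ 0) :
    ∑ w, condW μ t w = 1 := by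
  simp_rw [condW_eq_div]
  rw [← Finset.sum_div, ← measureReal_evT, div_self]
  exact (measureReal_ne_zero_iff (measure_ne_top _ _)).2 h

lemma sum_margW (μ : Measure (Obs W)) [IsProbabilityMeasure μ] : ∑ w, margW μ w = 1 := by
  have h : (Set.univ : Set (Obs W)) = ⋃ w, {x : Obs W | x.1 = w} := by
    ext x
    simp
  rw [← probReal_univ (μ := μ), h, measureReal_iUnion_fintype _ measurableSet_fst]
  · rfl
  · intro w w' hww
    refine Set.disjoint_left.2 fun x hx hx' => hww ?_
    exact Eq.trans (Eq.symm hx) hx'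

lemma condW_congr {μ ν : Measure (Obs W)} [IsFiniteMeasure μ] [IsFiniteMeasure ν]
    (h : ∀ w t, ν (evWT w t) = μ (evWT w t)) (t : Bool) (w : W) : condW ν t w = condW μ t w := by
  have h' : ∀ w t, ν.real (evWT w t) = μ.real (evWT w t) := fun w t => by
    rw [measureReal_def, h, measureReal_def]
  rw [condW_eq_div, condW_eq_div, measureReal_evT, measureReal_evT, h']
  simp_rw [h']

/-- The regression formula `E_P[Y | T = t] = ∑_w P(w | t) E_Q[Y | t, w]`. -/
lemma meanGivenT_eq_sum {Q P : Measure (Obs W)} [IsProbabilityMeasure P]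
    (hinv : CausalInvariant Q P) (hint : ∀ w t, Integrable (fun y : ℝ => y) (condY Q w t))
    (t : Bool) : meanGivenT P t = ∑ w, condW P t w * condMean Q w t := by
  have hrestrict : ∀ w, (ProbabilityTheory.cond P (evT t)).restrict {x | x.1 = w}
      = (P (evT t))⁻¹ • P.restrict (evWT w t) := by
    intro w
    rw [ProbabilityTheory.cond, Measure.restrict_smul,
      Measure.restrict_restrict (measurableSet_fst w), Set.inter_comm, evT_inter_fst]
  have hcell : ∀ w, P (evWT w t) ≠ 0 →
      P.restrict (evWT w t) = P (evWT w t) • ProbabilityTheory.cond P (evWT w t) := by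
    intro w hw
    rw [ProbabilityTheory.cond, smul_smul, ENNReal.mul_inv_cancel hw (measure_ne_top _ _),
      one_smul]
  have hcond : ∀ w, P (evWT w t) ≠ 0 →
      Integrable (fun x : Obs W => x.2.2) (ProbabilityTheory.cond P (evWT w t)) := by
    intro w hw
    have h1 := hint w t
    rw [← hinv w t hw, condY] at h1
    exact h1.comp_measurable measurable_outcome
  have hI : ∀ w, IntegrableOn (fun x : Obs W => x.2.2) {x | x.1 = w}
      (ProbabilityTheory.cond P (evT t)) := by
    intro w
    rw [IntegrableOn, hrestrict]
    -- Invariance is only available on charged cells; null cells contribute nothing.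
    by_cases hw : P (evWT w t) = 0
    · rw [Measure.restrict_eq_zero.2 hw, smul_zero]
      exact integrable_zero_measure
    · have hT : P (evT t) ≠ 0 := fun h0 => hw (measure_mono_null (fun x hx => hx.2) h0)
      rw [hcell w hw]
      exact ((hcond w hw).smul_measure (measure_ne_top _ _)).smul_measure (ENNReal.inv_ne_top.2 hT)
  have hU : (Set.univ : Set (Obs W)) = ⋃ w, {x : Obs W | x.1 = w} := by
    ext x
    simp
  rw [meanGivenT, ← setIntegral_univ, hU, integral_iUnion_fintype measurableSet_fst _ hI]
  · refine Finset.sum_congr rfl fun w _ => ?_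
    rw [hrestrict, condW_eq_div]
    by_cases hw : P (evWT w t) = 0
    · rw [Measure.restrict_eq_zero.2 hw, smul_zero, integral_zero_measure, measureReal_def, hw]
      simp
    · rw [hcell w hw, integral_smul_measure, integral_smul_measure, condMean, ← hinv w t hw, condY,
        integral_map (f := fun y : ℝ => y) measurable_outcome.aemeasurable
          measurable_id.aestronglyMeasurable]
      simp only [smul_eq_mul, ENNReal.toReal_inv, measureReal_def]
      rw [← mul_assoc, div_eq_inv_mul]
  · intro w w' hww
    refine Set.disjoint_left.2 fun x hx hx' => hww ?_
    exact Eq.trans (Eq.symm hx) hx'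

end Cells

/-! ### The weighted estimator as `α` of a robust version of the sample -/

section Estimator

variable {W : Type*} [MeasurableSpace W] {n : ℕ}

lemma empirical_eq_sampleMeasure (x : Fin n → Obs W) :
    empirical x = sampleMeasure x Finset.univ := by
  simp [empirical, sampleMeasure]

lemma empirical_real_evT (x : Fin n → Obs W) (t : Bool) :
    (empirical x).real (evT t) = ((Finset.univ.filter fun i => (x i).2.1 = t).card : ℝ) / n := by
  classical
  rw [empirical_eq_sampleMeasure, sampleMeasure_real x _ (measurableSet_evT t),
    Finset.card_univ, Fintype.card_fin]
  congr!

/-- The weight turns `Q_B(w | t)` into `R(w | t)`, and overlap makes the robust mean available in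
every cell. -/
lemma alpha_eq_sum_condW [Fintype W] {Q QB R : Measure (Obs W)} {m β : W → Bool → ℝ}
    (hQ : ∀ w t, Q (evWT w t) ≠ 0) (hQB : IsRobustVersion Q m QB) (hR : IsWeightedRep QB β R)
    (t : Bool) : alpha QB β t = ∑ w, condW R t w * m w t :=
  Finset.sum_congr rfl fun w _ => by rw [← hR.weight, hQB.mean w t (hQ w t)]

variable [MeasurableSingletonClass W] [DecidableEq W]

lemma empirical_real_evWT (x : Fin n → Obs W) (w : W) (t : Bool) :
    (empirical x).real (evWT w t) = ((cell x w t).card : ℝ) / n := by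
  classical
  rw [empirical_eq_sampleMeasure, sampleMeasure_real x _ (measurableSet_evWT w t),
    Finset.card_univ, Fintype.card_fin]
  congr 3
  ext i
  simp only [cell, Finset.mem_filter, Finset.mem_univ, true_and]
  rfl

variable [Fintype W]

lemma weightedMean_eq_alpha (hn : 0 < n) (x : Fin n → Obs W) {m βhat : W → Bool → ℝ}
    {ν : Measure (Obs W)} (hν : IsRobustVersion (empirical x) m ν) (t : Bool) :
    weightedMean x βhat m t = alpha ν βhat t := by
  have hn0 : (n : ℝ) ≠ 0 := by exact_mod_cast hn.ne'
  have := hν.prob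
  have hfin : IsFiniteMeasure (empirical x) := by
    rw [empirical_eq_sampleMeasure]; infer_instance
  have hterm : ∀ w, βhat w t * condW ν t w * condMean ν w t
      = ((cell x w t).card : ℝ) * (βhat w t * m w t)
        / ((Finset.univ.filter fun i => (x i).2.1 = t).card : ℝ) := by
    intro w
    rw [condW_congr hν.marginal, condW_eq_div, empirical_real_evWT, empirical_real_evT,
      div_div_div_cancel_right₀ hn0]
    -- In an empty cell the robust mean is unconstrained, but its coefficient is zero.
    by_cases hw : empirical x (evWT w t) = 0
    · have h0 := empirical_real_evWT x w t
      rw [measureReal_def, hw, ENNReal.toReal_zero, eq_comm, div_eq_zero_iff] at h0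
      rw [h0.resolve_right hn0]
      simp
    · rw [hν.mean w t hw]
      ring
  rw [weightedMean, alpha, Finset.sum_congr rfl fun w _ => hterm w, ← Finset.sum_div]
  congr 1
  rw [← Finset.sum_fiberwise _ fun i => (x i).1]
  refine Finset.sum_congr rfl fun w _ => ?_
  have hcell : (Finset.univ.filter fun i => (x i).2.1 = t).filter (fun i => (x i).1 = w)
      = cell x w t := by
    ext i
    simp [cell, and_comm]
  rw [hcell, Finset.sum_congr rfl (g := fun _ => βhat w t * m w t), Finset.sum_const, nsmul_eq_mul]
  intro i hi
  simp only [cell, Finset.mem_filter] at hi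
  rw [hi.2.1]

/-- The loss bound holds for every shift with `γ_t = ∑_w R(w | t) (E_Q[Y | t, w] - m(w, t))`. -/
lemma l1Loss_le_lossBound (hn : 0 < n) (x : Fin n → Obs W) {Q P QB QBhat R : Measure (Obs W)}
    [IsProbabilityMeasure P] {m β βhat : W → Bool → ℝ} {γ : Bool → ℝ}
    (hinv : CausalInvariant Q P) (hint : ∀ w t, Integrable (fun y : ℝ => y) (condY Q w t))
    (hQ : ∀ w t, Q (evWT w t) ≠ 0) (hQB : IsRobustVersion Q m QB)
    (hQBhat : IsRobustVersion (empirical x) m QBhat) (hR : IsWeightedRep QB β R)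
    (hγ : ∀ t, γ t = ∑ w, condW R t w * (condMean Q w t - m w t)) :
    l1Loss (hEst x βhat m) (ape P) ≤ lossBound Q P R QB QBhat β βhat γ := by
  have key : ∀ t, weightedMean x βhat m t - meanGivenT P t
      = (alpha QBhat βhat t - alpha QB β t - γ t) + wld Q R P t := by
    intro t
    rw [weightedMean_eq_alpha hn x hQBhat, meanGivenT_eq_sum hinv hint,
      alpha_eq_sum_condW hQ hQB hR, hγ, wld]
    simp only [mul_sub, sub_mul, Finset.sum_sub_distrib]
    ring
  have hdiff : hEst x βhat m - ape P = (weightedMean x βhat m true - meanGivenT P true)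
      - (weightedMean x βhat m false - meanGivenT P false) := by
    rw [hEst, ape]; ring
  rw [l1Loss, lossBound, hdiff]
  have h1 := abs_sub (weightedMean x βhat m true - meanGivenT P true)
    (weightedMean x βhat m false - meanGivenT P false)
  have h2 := abs_add_le (alpha QBhat βhat true - alpha QB β true - γ true) (wld Q R P true)
  have h3 := abs_add_le (alpha QBhat βhat false - alpha QB β false - γ false) (wld Q R P false)
  rw [← key] at h2 h3
  linarith

end Estimator

/-! ### From frequencies to conditional laws in the cells -/

section Conditional

variable {W : Type*}

/-- The number of records in a cell with outcome in `A`. -/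
lemma sum_indicator_cell [DecidableEq W] {n : ℕ} (x : Fin n → Obs W) (w : W) (t : Bool)
    {A : Set ℝ} (hA : MeasurableSet A) :
    ∑ i, (evWT w t ∩ {z | z.2.2 ∈ A}).indicator (fun _ => (1 : ℝ)) (x i)
      = (cell x w t).card * (sampleMeasure (fun i => (x i).2.2) (cell x w t)).real A := by
  classical
  rw [sampleMeasure_real _ _ hA]
  have h1 : ∑ i, (evWT w t ∩ {z | z.2.2 ∈ A}).indicator (fun _ => (1 : ℝ)) (x i)
      = (((cell x w t).filter fun i => (x i).2.2 ∈ A).card : ℝ) := by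
    rw [cell, Finset.filter_filter, Finset.card_filter]
    push_cast
    refine Finset.sum_congr rfl fun i _ => ?_
    by_cases h : x i ∈ evWT w t ∩ {z | z.2.2 ∈ A}
    · exact (Set.indicator_of_mem h _).trans (if_pos h).symm
    · exact (Set.indicator_of_notMem h _).trans (if_neg h).symm
  rw [h1]
  rcases (cell x w t).eq_empty_or_nonempty with h | h
  · simp [h]
  · have : ((cell x w t).card : ℝ) ≠ 0 := by exact_mod_cast h.card_pos.ne'
    field_simp

/-- The comparison sets in a cell: the whole cell, and the records with outcome at most (below) a
grid point. -/
def gridSet {m : ℕ} (q : W → Bool → Fin m → ℝ) :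
    W × Bool × Option (Fin m × Bool) → Set (Obs W)
  | (w, t, none) => evWT w t ∩ {z | z.2.2 ∈ Set.univ}
  | (w, t, some (j, true)) => evWT w t ∩ {z | z.2.2 ∈ Set.Iic (q w t j)}
  | (w, t, some (j, false)) => evWT w t ∩ {z | z.2.2 ∈ Set.Iio (q w t j)}

variable [MeasurableSpace W] [MeasurableSingletonClass W]

lemma measurableSet_gridSet {m : ℕ} (q : W → Bool → Fin m → ℝ)
    (c : W × Bool × Option (Fin m × Bool)) : MeasurableSet (gridSet q c) := by
  have h : ∀ (w : W) (t : Bool) {A : Set ℝ}, MeasurableSet A →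
      MeasurableSet (evWT w t ∩ {z : Obs W | z.2.2 ∈ A}) := fun w t A hA =>
    (measurableSet_evWT w t).inter (measurable_outcome hA)
  match c with
  | (w, t, none) => exact h w t MeasurableSet.univ
  | (w, t, some (j, true)) => exact h w t measurableSet_Iic
  | (w, t, some (j, false)) => exact h w t measurableSet_Iio

/-- For a fixed accuracy `e₀`, finitely many frequencies control the deviation of the empirical
conditional law of the outcome from the true one on all closed intervals, in every cell. -/
lemma exists_gridSet_control [DecidableEq W] {μ : Measure (Obs W)} [IsProbabilityMeasure μ]
    {ρ e₀ e : ℝ} (hρ : 0 < ρ) (hoverlap : ∀ w t, ρ ≤ μ.real (evWT w t)) {m : ℕ} (hm : 0 < m)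
    (hme : 8 / (m : ℝ) ≤ e₀) (he : e ≤ ρ / 2) (hee : 12 * e ≤ ρ * e₀) :
    ∃ q : W → Bool → Fin m → ℝ, ∀ {n : ℕ} (_ : 0 < n) (x : Fin n → Obs W),
      (∀ c, |(∑ i, (gridSet q c).indicator (fun _ => (1 : ℝ)) (x i)) / n - μ.real (gridSet q c)|
        ≤ e) →
      ∀ w t, (cell x w t).Nonempty ∧ ∀ a b,
        |(sampleMeasure (fun i => (x i).2.2) (cell x w t)).real (Set.Icc a b)
          - (condY μ w t).real (Set.Icc a b)| ≤ e₀ := by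
  have hprob : ∀ w t, IsProbabilityMeasure (condY μ w t) := fun w t =>
    isProbabilityMeasure_condY fun h0 => by
      have := hoverlap w t
      rw [measureReal_def, h0, ENNReal.toReal_zero] at this
      linarith
  choose q hq using fun w t => exists_grid (condY μ w t) hm
  refine ⟨q, fun {n} hn x hx w t => ?_⟩
  have hn0 : (0 : ℝ) < n := by exact_mod_cast hn
  set s := cell x w t with hs
  set p := μ.real (evWT w t) with hp
  set p' := (s.card : ℝ) / n with hp'
  set ν' := sampleMeasure (fun i => (x i).2.2) s with hν'
  have hpρ : ρ ≤ p := hoverlap w t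
  have hset : ∀ {A : Set ℝ}, MeasurableSet A →
      |(∑ i, (evWT w t ∩ {z | z.2.2 ∈ A}).indicator (fun _ => (1 : ℝ)) (x i)) / n
        - μ.real (evWT w t ∩ {z | z.2.2 ∈ A})| ≤ e →
      |p' * ν'.real A - p * (condY μ w t).real A| ≤ e := by
    intro A hA h
    rwa [sum_indicator_cell x w t hA, measureReal_evWT_mul_condY μ w t hA,
      mul_div_right_comm] at h
  have huniv := hset MeasurableSet.univ (hx (w, t, none))
  -- An empty cell would have frequency `0`, hence deviation at least `ρ > e`.
  have hne : s.Nonempty := by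
    by_contra hcon
    have h0 : p' = 0 := by rw [hp', Finset.not_nonempty_iff_eq_empty.1 hcon]; simp
    rw [h0, zero_mul, probReal_univ, mul_one, zero_sub, abs_neg, abs_of_pos (by linarith)] at huniv
    linarith
  have : Nonempty s := hne.coe_sort
  rw [probReal_univ, probReal_univ, mul_one, mul_one] at huniv
  refine ⟨hne, fun a b => ?_⟩
  have hIcc := hq w t ν' p p' e (by linarith) (by positivity) huniv
    (fun j => hset measurableSet_Iic (hx (w, t, some (j, true))))
    (fun j => hset measurableSet_Iio (hx (w, t, some (j, false)))) a b
  set v' := ν'.real (Set.Icc a b) with hv'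
  set v := (condY μ w t).real (Set.Icc a b) with hv
  have hv0 : 0 ≤ v := measureReal_nonneg
  have hv1 : v ≤ 1 := measureReal_le_one
  have hp'2 : p / 2 ≤ p' := by linarith [(abs_le.1 huniv).1]
  have h1 : |p' * (v' - v)| ≤ 3 * e + 2 * (p / m) := by
    have h2 : |(p' - p) * v| ≤ e := by
      rw [abs_mul, abs_of_nonneg hv0]
      exact (mul_le_of_le_one_right (abs_nonneg _) hv1).trans huniv
    calc |p' * (v' - v)| = |(p' * v' - p * v) - (p' - p) * v| := by congr 1; ring
      _ ≤ |p' * v' - p * v| + |(p' - p) * v| := abs_sub _ _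
      _ ≤ _ := by linarith
  have he₀ : 0 ≤ e₀ := le_trans (by positivity) hme
  -- Each summand is at most `p e₀ / 4`, by `12 e ≤ ρ e₀` and `8 / m ≤ e₀`; dividing by `p' ≥ p / 2`
  -- then gives `e₀`.
  have h3 : 3 * e + 2 * (p / m) ≤ p / 2 * e₀ := by
    have h4 : p * (8 / m) ≤ p * e₀ := mul_le_mul_of_nonneg_left hme (by linarith)
    have h5 : ρ * e₀ ≤ p * e₀ := mul_le_mul_of_nonneg_right hpρ he₀
    have h6 : p * (8 / m) = 8 * (p / m) := by ring
    linarith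
  have hp0 : 0 < p / 2 := by linarith
  have h7 : p / 2 * |v' - v| ≤ p / 2 * e₀ := by
    rw [abs_mul, abs_of_pos (hp0.trans_le hp'2)] at h1
    exact (mul_le_mul_of_nonneg_right hp'2 (abs_nonneg _)).trans (h1.trans h3)
  exact le_of_mul_le_mul_left h7 hp0

end Conditional

end CausalBound

end

/-! ### Choice of the accuracies and assembly of the bound -/

theorem theorem5p2 (η₀ : ℝ) (hη₀ : η₀ < 1) (hbreak : η₀ < (1 - η₀) ^ 2) :
    ∃ K : ℝ, 0 < K ∧
    ∀ (W : Type*) [Fintype W] [DecidableEq W] [MeasurableSpace W] [MeasurableSingletonClass W]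
      (ε ρ : ℝ) (k : ℕ), 0 < ε → 0 < ρ →
    ∃ n₀ : ℕ, ∀ n : ℕ, n₀ ≤ n →
    ∀ (U : Type*) [MeasurableSpace U] (η C : ℝ), 0 ≤ η → η + ε ≤ η₀ → 0 ≤ C →
    ∀ (Q Qobs P : Measure (CausalBound.Obs W))
      [IsProbabilityMeasure Q] [IsProbabilityMeasure Qobs] [IsProbabilityMeasure P]
      (QU : W → Bool → Measure U) (QYU : W → Bool → Kernel U ℝ)
      [∀ w t, IsProbabilityMeasure (QU w t)] [∀ w t, IsMarkovKernel (QYU w t)]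
      (σ : W → Bool → ℝ),
    -- overlap
    (∀ w t, ρ ≤ Q.real (CausalBound.evWT w t)) →
    -- the target distribution shares the causal mechanism
    (∀ t, P (CausalBound.evT t) ≠ 0) →
    CausalBound.CausalInvariant Q P →
    -- conditional standard deviation at most `σ`, and bounded fourth moment
    (∀ w t, 0 ≤ σ w t) →
    (∀ w t, MemLp (fun y : ℝ => y) 4 (CausalBound.condY Q w t)) →
    (∀ w t, ∫ y, (y - CausalBound.condMean Q w t) ^ 2 ∂(CausalBound.condY Q w t) ≤ σ w t ^ 2) →
    (∀ w t, ∫ y, (y - CausalBound.condMean Q w t) ^ 4 ∂(CausalBound.condY Q w t)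
      ≤ C * σ w t ^ 4) →
    CausalBound.IsHuberContamination η Q Qobs QU QYU →
    -- an i.i.d. sample of size `n` from the observed law
    ∀ (Ω : Type*) [MeasurableSpace Ω] (Pr : Measure Ω) [IsProbabilityMeasure Pr]
      (X : Fin n → Ω → CausalBound.Obs W),
    (∀ i, Measurable (X i)) → iIndepFun X Pr → (∀ i, Pr.map (X i) = Qobs) →
    ∃ G : Set Ω, MeasurableSet G ∧
      (1 - 1 / (n : ℝ) ^ k) ^ (2 * Fintype.card W) ≤ Pr.real G ∧
      ∀ ω ∈ G, ∀ Yhat : W → Bool → ℝ,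
        (∀ w t, CausalBound.IsAgnosticMean η ε (fun i => (X i ω).2.2)
          (CausalBound.cell (fun i => X i ω) w t) (Yhat w t)) →
        ∃ δ : W → Bool → ℝ,
          (∀ w t, |δ w t| ≤ K * (C ^ (1 / 4 : ℝ) * (η + ε) ^ (3 / 4 : ℝ) * σ w t)) ∧
          ∀ (QB QBhat R : Measure (CausalBound.Obs W)) (β βhat : W → Bool → ℝ),
            CausalBound.IsRobustVersion Q Yhat QB →
            CausalBound.IsRobustVersion (CausalBound.empirical fun i => X i ω) Yhat QBhat →
            CausalBound.IsWeightedRep QB β R →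
            CausalBound.l1Loss (CausalBound.hEst (fun i => X i ω) βhat Yhat) (CausalBound.ape P)
                ≤ CausalBound.lossBound Q P R QB QBhat β βhat
                    (fun t => ∑ w, CausalBound.condW R t w * δ w t) ∧
            -- the shift in the form `∑_w Q(w) O(C^{1/4} (η + ε)^{3/4} σ)`
            (((∀ w t, CausalBound.condW R t w = CausalBound.margW Q w) ∨
                (∀ w t w' t', σ w t = σ w' t')) →
              ∃ δ' : W → Bool → ℝ,
                (∀ w t, |δ' w t| ≤ K * (C ^ (1 / 4 : ℝ) * (η + ε) ^ (3 / 4 : ℝ) * σ w t)) ∧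
                CausalBound.l1Loss (CausalBound.hEst (fun i => X i ω) βhat Yhat)
                    (CausalBound.ape P)
                  ≤ CausalBound.lossBound Q P R QB QBhat β βhat
                      (fun t => ∑ w, CausalBound.margW Q w * δ' w t)) := by
  refine ⟨CausalBound.agnosticConst η₀, CausalBound.agnosticConst_pos hη₀ hbreak, ?_⟩
  intro W _ _ _ _ ε ρ k hε hρ
  have hK := CausalBound.agnosticConst_pos hη₀ hbreak
  obtain ⟨e₀, he₀⟩ : ∃ e₀ : ℝ, e₀ = (1 - η₀) / 2 * ε := ⟨_, rfl⟩
  have he₀pos : 0 < e₀ := by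
    rw [he₀]
    exact mul_pos (by linarith) hε
  obtain ⟨m, hm⟩ := exists_nat_gt (8 / e₀)
  have hm0 : (0 : ℝ) < m := lt_trans (by positivity) hm
  have hme : 8 / (m : ℝ) ≤ e₀ := by
    rw [div_lt_iff₀ he₀pos] at hm
    rw [div_le_iff₀ hm0]
    linarith
  obtain ⟨e, hepos, he1, he2⟩ : ∃ e : ℝ, 0 < e ∧ e ≤ ρ / 2 ∧ 12 * e ≤ ρ * e₀ := by
    have h12 : 0 < ρ * e₀ / 12 := by positivity
    refine ⟨min (ρ / 2) (ρ * e₀ / 12), lt_min (by linarith) h12, min_le_left _ _, ?_⟩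
    linarith [min_le_right (ρ / 2) (ρ * e₀ / 12)]
  -- The number of comparison events depends only on `W` and `m`, so `n₀` is fixed before any law is
  -- chosen; only the grid points depend on the law.
  obtain ⟨n₀, hn₀, hfail⟩ := CausalBound.exists_forall_mul_exp_le
    (Fintype.card (W × Bool × Option (Fin m × Bool)) : ℝ) (c := 2 * e ^ 2) (by positivity) k
  refine ⟨n₀, fun n hn U _ η C hη hηε hC Q Qobs P _ _ _ QU QYU _ _ σ hoverlap hPT hinv hσ hmem _
    hmom hhub Ω _ Pr _ X hX hind hlaw => ?_⟩
  have hnpos : 0 < n := lt_of_lt_of_le hn₀ hn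
  have hQ : ∀ w t, Q (CausalBound.evWT w t) ≠ 0 := fun w t h0 => by
    have := hoverlap w t
    rw [measureReal_def, h0, ENNReal.toReal_zero] at this
    linarith
  have hoverlap' : ∀ w t, ρ ≤ Qobs.real (CausalBound.evWT w t) := fun w t => by
    rw [measureReal_def, hhub.marginal]
    exact hoverlap w t
  obtain ⟨q, hq⟩ := CausalBound.exists_gridSet_control hρ hoverlap' (by exact_mod_cast hm0) hme
    he1 he2
  obtain ⟨G, hG, hGprob, hGdev⟩ := CausalBound.exists_good_event hnpos hX hind hlaw
    (CausalBound.measurableSet_gridSet q) hepos.le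
  refine ⟨G, hG, ?_, fun ω hω Yhat hYhat => ?_⟩
  -- One union bound over all cells gives probability at least `1 - n⁻ᵏ`, which dominates its power
  -- as soon as the exponent `2|W|` is nonzero.
  · have hW : Nonempty W := by
      by_contra hcon
      rw [not_nonempty_iff] at hcon
      have h1 := measure_univ (μ := Q)
      rw [Set.univ_eq_empty_iff.2 (Prod.isEmpty_left), measure_empty] at h1
      exact zero_ne_one h1
    have hnk : (1 : ℝ) ≤ (n : ℝ) ^ k := one_le_pow₀ (by exact_mod_cast hnpos)
    have h1 : 0 ≤ 1 - 1 / (n : ℝ) ^ k := by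
      rw [sub_nonneg, div_le_one (by linarith)]
      exact hnk
    have h2 : 1 - 1 / (n : ℝ) ^ k ≤ 1 := by
      have : 0 ≤ 1 / (n : ℝ) ^ k := by positivity
      linarith
    have h3 := pow_le_of_le_one h1 h2 (n := 2 * Fintype.card W)
      (mul_ne_zero two_ne_zero Fintype.card_ne_zero)
    linarith [hfail n hn]
  have hclose := hq hnpos (fun i => X i ω) (hGdev ω hω)
  have hint : ∀ w t, Integrable (fun y : ℝ => y) (CausalBound.condY Q w t) := fun w t => by
    have := CausalBound.isProbabilityMeasure_condY (hQ w t)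
    exact (hmem w t).integrable (by norm_num)
  have herr : ∀ w t, |CausalBound.condMean Q w t - Yhat w t|
      ≤ CausalBound.agnosticConst η₀ * (C ^ (1 / 4 : ℝ) * (η + ε) ^ (3 / 4 : ℝ) * σ w t) := by
    intro w t
    have := CausalBound.isProbabilityMeasure_condY (hQ w t)
    have : IsProbabilityMeasure (CausalBound.condY Qobs w t) :=
      CausalBound.isProbabilityMeasure_condY (by rw [hhub.marginal]; exact hQ w t)
    have hB : (C ^ (1 / 4 : ℝ) * σ w t) ^ 4 = C * σ w t ^ 4 := by
      rw [mul_pow, ← Real.rpow_natCast, ← Real.rpow_mul hC]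
      norm_num
    have h := (hYhat w t).abs_sub_le_rpow (B := C ^ (1 / 4 : ℝ) * σ w t)
      (c := CausalBound.condMean Q w t) hη₀ hbreak hη hε hηε
      he₀.le (mul_nonneg (Real.rpow_nonneg hC _) (hσ w t)) (hhub.mixture w t) (hclose w t).1
      (hclose w t).2 (hmem w t) rfl (by rw [hB]; exact hmom w t)
    rw [abs_sub_comm]
    refine h.trans (le_of_eq ?_)
    ring
  refine ⟨fun w t => CausalBound.condMean Q w t - Yhat w t, herr,
    fun QB QBhat R β βhat hQB hQBhat hR => ⟨?_, ?_⟩⟩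
  · exact CausalBound.l1Loss_le_lossBound hnpos _ hinv hint hQ hQB hQBhat hR fun t => rfl
  rintro (hipw | hconst)
  · refine ⟨fun w t => CausalBound.condMean Q w t - Yhat w t, herr, ?_⟩
    refine CausalBound.l1Loss_le_lossBound hnpos _ hinv hint hQ hQB hQBhat hR fun t => ?_
    simp only [hipw]
  · have := hR.prob
    -- With constant `σ` the `R`-average of `δ` obeys the same bound as each term. Taken as a shift
    -- independent of `w`, it is unchanged by averaging over `Q(w)`.
    refine ⟨fun _ t => ∑ w, CausalBound.condW R t w * (CausalBound.condMean Q w t - Yhat w t),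
      fun w t => ?_, ?_⟩
    · calc |∑ w', CausalBound.condW R t w' * (CausalBound.condMean Q w' t - Yhat w' t)|
          ≤ ∑ w', |CausalBound.condW R t w' * (CausalBound.condMean Q w' t - Yhat w' t)| :=
            Finset.abs_sum_le_sum_abs _ _
        _ ≤ ∑ w', CausalBound.condW R t w' * (CausalBound.agnosticConst η₀
              * (C ^ (1 / 4 : ℝ) * (η + ε) ^ (3 / 4 : ℝ) * σ w t)) := by
            refine Finset.sum_le_sum fun w' _ => ?_
            have h0 : 0 ≤ CausalBound.condW R t w' := measureReal_nonneg
            rw [abs_mul, abs_of_nonneg h0, hconst w t w' t]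
            exact mul_le_mul_of_nonneg_left (herr w' t) h0
        _ = _ := by rw [← Finset.sum_mul, CausalBound.sum_condW (hR.pos t), one_mul]
    · refine CausalBound.l1Loss_le_lossBound hnpos _ hinv hint hQ hQB hQBhat hR fun t => ?_
      simp only
      rw [← Finset.sum_mul, CausalBound.sum_margW, one_mul]
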